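/- A convex body in $\mathbb R^n$ is a compact convex set with non-empty interior. A convex body $K\subset\mathbb R^n$ is called isotropic, with isotropic constant $L_K\ge 0$, if $\mathrm{vol}(K)=1$, $\int_K x\,dx=0$, and $\int_K\langle x,\theta\rangle^2\,dx=L_K^2$ for every unit vector $\theta\in\mathbb R^n$. For $v_0,\dots,v_n\in\mathbb R^n$ let $S(v_0,\dots,v_n)$ denote their convex hull. There is an absolute constant $c_2>0$ such that for every $n\geq 1$, every isotropic convex body $K\subset\mathbb R^n$, and all independent random vectors $X_1,\dots,X_n$ uniformly distributed in $K$, $$\mathbb P\left\{\mathrm{vol}\bigl(S(0,X_1,\dots,X_n)\bigr)\ \ge\ \frac{c_2^{\,n}\,L_K^{\,n}}{n^{n/2}}\right\}\ >\ 1-\frac12 e^{-n}.$$ -/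

import Mathlib

open MeasureTheory ProbabilityTheory

/-- The convex body `K ⊆ ℝⁿ` is isotropic, with isotropic constant `L`: it has non-empty interior
(Mathlib's `ConvexBody` only asks for a non-empty compact convex set), volume one, barycenter at
the origin, and `∫_K ⟨x, θ⟩² dx = L²` for every unit vector `θ`, where `L ≥ 0`.
The integrands are continuous and `K` is compact, so all the integrals converge; for `n ≥ 1` the
number `L` is determined by `K`. -/
structure IsIsotropic {n : ℕ} (K : ConvexBody (EuclideanSpace ℝ (Fin n))) (L : ℝ) : Prop where
  interior_nonempty : (interior (K : Set (EuclideanSpace ℝ (Fin n)))).Nonempty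
  volume_eq_one : volume (K : Set (EuclideanSpace ℝ (Fin n))) = 1
  barycenter_eq_zero : ∫ x in (K : Set (EuclideanSpace ℝ (Fin n))), x = 0
  const_nonneg : 0 ≤ L
  integral_inner_sq : ∀ θ : EuclideanSpace ℝ (Fin n), ‖θ‖ = 1 →
    ∫ x in (K : Set (EuclideanSpace ℝ (Fin n))), (inner ℝ x θ) ^ 2 = L ^ 2

/-- `S(v₀, …, vₙ)`, the convex hull of the points `v₀, …, vₙ` of `ℝⁿ`. -/
def simplexHull {n : ℕ} (v : Fin (n + 1) → EuclideanSpace ℝ (Fin n)) :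
    Set (EuclideanSpace ℝ (Fin n)) :=
  convexHull ℝ (Set.range v)

/-! The simplex on `0, X₁, …, Xₙ` has volume at least `|det X| / n ^ n`, so the task is to show that
the determinant is rarely small. This follows from Markov's inequality for `|det X| ^ (-1/2)`: the
order `-1/2` is integrable near zero on the line, and the power is multiplicative.

The determinant is linear in each row: with the other rows fixed it is `⟨v, ·⟩`. For a uniform point
of `K` the moment of `|⟨v, x⟩| ^ (-1/2)` is at most `1025 (L ‖v‖) ^ (-1/2)`, while for a standard
Gaussian vector it equals `κ ‖v‖ ^ (-1/2)`. Both scale alike in `v`, so rows can be exchanged for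
Gaussian ones one at a time, at the cost of a fixed factor each
(`lintegral_pi_le_pow_mul_lintegral_pi`). The Gaussian determinant is handled by rotation
invariance, which splits off one row norm at a time and gives `κ ^ n (n!) ^ (-1/4)`.

The bound on `K` needs a bounded density for `⟨θ, x⟩`. By Prékopa–Leindler this density is
log-concave; a log-concave density of height about `m` decays exponentially on the scale `1 / m`, so
its standard deviation is at most a constant over `m`. As that deviation is `L`, the height is at
most a constant over `L` (`IsLogConcave.le_of_variance_ge`). -/

open scoped ENNReal Pointwise

/-! ### Brunn–Minkowski and Prékopa–Leindler on the line -/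

/-- One-dimensional Brunn–Minkowski inequality. -/
theorem Real.volume_add_volume_le_volume_add {A B : Set ℝ} (hA : MeasurableSet A)
    (hB : MeasurableSet B) (hA' : A.Nonempty) (hB' : B.Nonempty) :
    volume A + volume B ≤ volume (A + B) := by
  have key : ∀ K ⊆ A, IsCompact K → ∀ K' ⊆ B, IsCompact K' →
      volume K + volume K' ≤ volume (A + B) := by
    intro K hKA hK K' hKB hK'
    rcases K.eq_empty_or_nonempty with rfl | hKn
    · obtain ⟨a, ha⟩ := hA'
      rw [measure_empty, zero_add, ← measure_vadd volume a K']
      refine measure_mono ?_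
      rintro _ ⟨y, hy, rfl⟩
      exact Set.add_mem_add ha (hKB hy)
    rcases K'.eq_empty_or_nonempty with rfl | hKn'
    · obtain ⟨b, hb⟩ := hB'
      rw [measure_empty, add_zero, ← measure_vadd volume b K]
      refine measure_mono ?_
      rintro _ ⟨y, hy, rfl⟩
      rw [show (fun x => b +ᵥ x) y = y + b from add_comm _ _]
      exact Set.add_mem_add (hKA hy) hb
    -- The translates `min K' + K` and `max K + K'` both lie in `A + B` and meet only at `max K +
    -- min K'`.
    have ha := hK.isGreatest_sSup hKn
    have hb := hK'.isLeast_sInf hKn'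
    set a := sSup K
    set b := sInf K'
    rw [← measure_vadd volume b K, ← measure_vadd volume a K']
    have hdisj : AEDisjoint volume (b +ᵥ K) (a +ᵥ K') := by
      refine measure_mono_null (t := {a + b}) ?_ (by simp)
      rintro _ ⟨⟨x, hx, rfl⟩, ⟨y, hy, hxy⟩⟩
      have h1 := ha.2 hx
      have h2 := hb.2 hy
      simp only [vadd_eq_add, Set.mem_singleton_iff] at hxy ⊢
      linarith
    have hm : MeasurableSet (a +ᵥ K') := (hK'.vadd a).measurableSet
    rw [← measure_union₀ hm.nullMeasurableSet hdisj]
    refine measure_mono (Set.union_subset ?_ ?_)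
    · rintro _ ⟨x, hx, rfl⟩
      rw [show (fun x => b +ᵥ x) x = x + b from add_comm _ _]
      exact Set.add_mem_add (hKA hx) (hKB hb.1)
    · rintro _ ⟨y, hy, rfl⟩
      exact Set.add_mem_add (hKA ha.1) (hKB hy)
  rw [hA.measure_eq_iSup_isCompact, hB.measure_eq_iSup_isCompact]
  simp only [iSup_and']
  exact ENNReal.biSup_add_biSup_le' ⟨∅, by simp⟩ ⟨∅, by simp⟩
    fun K hK K' hK' => key K hK.1 hK.2 K' hK'.1 hK'.2

/-- Weighted one-dimensional Brunn–Minkowski inequality. -/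
theorem Real.volume_combination_le {A B S : Set ℝ} (hA : MeasurableSet A)
    (hB : MeasurableSet B) (hA' : A.Nonempty) (hB' : B.Nonempty) {a b : ℝ} (ha : 0 < a) (hb : 0 < b)
    (h : ∀ x ∈ A, ∀ y ∈ B, a * x + b * y ∈ S) :
    ENNReal.ofReal a * volume A + ENNReal.ofReal b * volume B ≤ volume S := by
  have h1 := Real.volume_add_volume_le_volume_add (hA.const_smul₀ a) (hB.const_smul₀ b)
    (hA'.smul_set) (hB'.smul_set)
  simp only [Measure.addHaar_smul, Module.finrank_self, pow_one, abs_of_pos ha, abs_of_pos hb] at h1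
  refine h1.trans (measure_mono ?_)
  rintro _ ⟨_, ⟨x, hx, rfl⟩, _, ⟨y, hy, rfl⟩, rfl⟩
  exact h x hx y hy

/-- Layer cake, with levels cut off at the bound 1. Below a common supremum 1 the superlevel sets of
both functions are non-empty, as Brunn–Minkowski requires. -/
theorem lintegral_eq_lintegral_Ioo_meas_lt {f : ℝ → ℝ≥0∞} (hf : Measurable f) (h1 : ∀ x, f x ≤ 1) :
    ∫⁻ x, f x = ∫⁻ t in Set.Ioo (0 : ℝ) 1, volume {x | ENNReal.ofReal t < f x} := by
  have hfin : ∀ x, f x ≠ ⊤ := fun x => ((h1 x).trans_lt ENNReal.one_lt_top).ne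
  have h := lintegral_eq_lintegral_meas_lt volume (f := fun x => (f x).toReal)
    (Filter.Eventually.of_forall fun x => ENNReal.toReal_nonneg) hf.ennreal_toReal.aemeasurable
  simp only [ENNReal.ofReal_toReal (hfin _)] at h
  rw [h, ← Set.Ioo_union_Ici_eq_Ioi (zero_lt_one' ℝ), lintegral_union measurableSet_Ici]
  · have h2 : ∫⁻ t in Set.Ici (1 : ℝ), volume {x | t < (f x).toReal} = 0 := by
      rw [setLIntegral_congr_fun (g := fun _ => 0) measurableSet_Ici]
      · simp
      · intro t ht
        have : {x | t < (f x).toReal} = ∅ := by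
          ext x
          have : (f x).toReal ≤ 1 := ENNReal.toReal_le_of_le_ofReal zero_le_one (by simpa using h1 x)
          simp only [Set.mem_ofPred_eq, Set.mem_empty_iff_false, iff_false, not_lt]
          exact this.trans ht
        simp [this]
    rw [h2, add_zero]
    refine setLIntegral_congr_fun measurableSet_Ioo ?_
    intro t ht
    simp only [ENNReal.ofReal_lt_iff_lt_toReal ht.1.le (hfin _)]
  · rw [Set.disjoint_left]
    intro x hx hx'
    exact absurd hx.2 (not_lt.2 hx')

theorem ENNReal.geom_mean_le_arith_mean2 {a b : ℝ} (ha : 0 < a) (hb : 0 < b) (hab : a + b = 1)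
    (x y : ℝ≥0∞) : x ^ a * y ^ b ≤ ENNReal.ofReal a * x + ENNReal.ofReal b * y := by
  by_cases hx : x = ⊤
  · simp [hx, ha, ENNReal.mul_top]
  by_cases hy : y = ⊤
  · simp [hy, hb, ENNReal.mul_top]
  lift x to NNReal using hx
  lift y to NNReal using hy
  lift a to NNReal using ha.le
  lift b to NNReal using hb.le
  rw [← ENNReal.coe_rpow_of_nonneg _ a.coe_nonneg, ← ENNReal.coe_rpow_of_nonneg _ b.coe_nonneg,
    ENNReal.ofReal_coe_nnreal, ENNReal.ofReal_coe_nnreal]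
  exact_mod_cast NNReal.geom_mean_le_arith_mean2_weighted a b x y (by exact_mod_cast hab)

/-- Prékopa–Leindler on the line for functions with supremum one, in additive form. -/
theorem lintegral_combination_le_of_iSup_eq_one {f g h : ℝ → ℝ≥0∞} (hf : Measurable f)
    (hg : Measurable g) (hh : Measurable h) {a b : ℝ} (ha : 0 < a) (hb : 0 < b) (hab : a + b = 1)
    (hf1 : ⨆ x, f x = 1) (hg1 : ⨆ x, g x = 1)
    (hfgh : ∀ x y, f x ^ a * g y ^ b ≤ h (a * x + b * y)) :
    ENNReal.ofReal a * (∫⁻ x, f x) + ENNReal.ofReal b * (∫⁻ x, g x) ≤ ∫⁻ x, h x := by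
  have hf1' : ∀ x, f x ≤ 1 := fun x => hf1 ▸ le_iSup f x
  have hg1' : ∀ x, g x ≤ 1 := fun x => hg1 ▸ le_iSup g x
  -- Truncating `h` at 1 makes the layer-cake formula available for it too.
  refine le_trans ?_ (lintegral_mono fun x => min_le_left (h x) 1)
  rw [lintegral_eq_lintegral_Ioo_meas_lt hf hf1', lintegral_eq_lintegral_Ioo_meas_lt hg hg1',
    lintegral_eq_lintegral_Ioo_meas_lt (hh.min measurable_const) (fun x => min_le_right _ _)]
  have hanti : ∀ k : ℝ → ℝ≥0∞, Measurable fun t : ℝ => volume {x | ENNReal.ofReal t < k x} := by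
    intro k
    refine Antitone.measurable fun s t hst => measure_mono fun x hx => ?_
    exact (ENNReal.ofReal_le_ofReal hst).trans_lt hx
  rw [← lintegral_const_mul _ (hanti f), ← lintegral_const_mul _ (hanti g),
    ← lintegral_add_left ((hanti f).const_mul _)]
  refine setLIntegral_mono' measurableSet_Ioo fun t ht => ?_
  have ht1 : ENNReal.ofReal t < 1 := by simpa using ht.2
  refine Real.volume_combination_le (measurableSet_lt measurable_const hf)
    (measurableSet_lt measurable_const hg) (lt_iSup_iff.1 (ht1.trans_eq hf1.symm))
    (lt_iSup_iff.1 (ht1.trans_eq hg1.symm)) ha hb fun x hx y hy => ?_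
  refine lt_min (lt_of_lt_of_le ?_ (hfgh x y)) ht1
  calc ENNReal.ofReal t = ENNReal.ofReal t ^ a * ENNReal.ofReal t ^ b := by
        rw [← ENNReal.rpow_add_of_nonneg _ _ ha.le hb.le, hab, ENNReal.rpow_one]
    _ < f x ^ a * g y ^ b :=
        ENNReal.mul_lt_mul (ENNReal.rpow_lt_rpow hx ha) (ENNReal.rpow_lt_rpow hy hb)

/-- The Prékopa–Leindler inequality on the line, for bounded functions. -/
theorem prekopa_leindler_real {f g h : ℝ → ℝ≥0∞} (hf : Measurable f)
    (hg : Measurable g) (hh : Measurable h) {a b : ℝ} (ha : 0 < a) (hb : 0 < b) (hab : a + b = 1)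
    (hfb : ⨆ x, f x ≠ ⊤) (hgb : ⨆ x, g x ≠ ⊤)
    (hfgh : ∀ x y, f x ^ a * g y ^ b ≤ h (a * x + b * y)) :
    (∫⁻ x, f x) ^ a * (∫⁻ x, g x) ^ b ≤ ∫⁻ x, h x := by
  set S := ⨆ x, f x with hS
  set T := ⨆ x, g x with hT
  by_cases hS0 : S = 0
  · have : ∀ x, f x = 0 := by simpa [hS] using hS0
    simp [this, ha]
  by_cases hT0 : T = 0
  · have : ∀ x, g x = 0 := by simpa [hT] using hT0
    simp [this, hb]
  have hSa : S ^ a ≠ 0 := by simp [hS0, hfb]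
  have hSa' : S ^ a ≠ ⊤ := by simp [hS0, hfb]
  have hTb : T ^ b ≠ 0 := by simp [hT0, hgb]
  have hTb' : T ^ b ≠ ⊤ := by simp [hT0, hgb]
  -- Normalise both suprema to 1; weighted AM–GM then turns the additive bound into the
  -- multiplicative one, and the scaling factors cancel.
  have main := lintegral_combination_le_of_iSup_eq_one (hf.const_mul S⁻¹) (hg.const_mul T⁻¹)
    (hh.const_mul ((S ^ a)⁻¹ * (T ^ b)⁻¹)) ha hb hab
    (by rw [← ENNReal.mul_iSup, ← hS, ENNReal.inv_mul_cancel hS0 hfb])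
    (by rw [← ENNReal.mul_iSup, ← hT, ENNReal.inv_mul_cancel hT0 hgb])
    (by
      intro x y
      rw [ENNReal.mul_rpow_of_nonneg _ _ ha.le, ENNReal.mul_rpow_of_nonneg _ _ hb.le,
        ENNReal.inv_rpow, ENNReal.inv_rpow, mul_mul_mul_comm]
      gcongr
      exact hfgh x y)
  have h2 := (ENNReal.geom_mean_le_arith_mean2 ha hb hab _ _).trans main
  rw [lintegral_const_mul _ hf, lintegral_const_mul _ hg, lintegral_const_mul _ hh,
    ENNReal.mul_rpow_of_nonneg _ _ ha.le, ENNReal.mul_rpow_of_nonneg _ _ hb.le,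
    ENNReal.inv_rpow, ENNReal.inv_rpow, mul_mul_mul_comm] at h2
  rw [← ENNReal.mul_inv (Or.inl hSa) (Or.inl hSa')] at h2
  exact (ENNReal.mul_le_mul_iff_right (ENNReal.inv_ne_zero.2 (ENNReal.mul_ne_top hSa' hTb'))
    (ENNReal.inv_ne_top.2 (mul_ne_zero hSa hTb))).1 h2

/-! ### Log-concave functions and marginals of convex bodies -/

/-- Log-concavity of an extended nonnegative function on a real vector space. -/
def IsLogConcave {V : Type*} [AddCommMonoid V] [Module ℝ V] (f : V → ℝ≥0∞) : Prop :=
  ∀ x y : V, ∀ a b : ℝ, 0 < a → 0 < b → a + b = 1 → f x ^ a * f y ^ b ≤ f (a • x + b • y)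

theorem Convex.isLogConcave_indicator {V : Type*} [AddCommMonoid V] [Module ℝ V] {K : Set V}
    (hK : Convex ℝ K) : IsLogConcave (K.indicator (1 : V → ℝ≥0∞)) := by
  intro x y a b ha hb hab
  by_cases hx : x ∈ K
  · by_cases hy : y ∈ K
    · simp [hx, hy, hK hx hy ha.le hb.le hab]
    · simp [hy, hb]
  · simp [hx, ha]

section Marginal

variable {ι : Type*} [DecidableEq ι]

/-- Marginals of bounded log-concave functions are log-concave (Prékopa). -/
theorem IsLogConcave.lmarginal {F : (ι → ℝ) → ℝ≥0∞} (hF : IsLogConcave F) (hFm : Measurable F)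
    (hb : ∀ s : Finset ι, ⨆ x, (∫⋯∫⁻_s, F ∂(fun _ => volume)) x ≠ ⊤) (s : Finset ι) :
    IsLogConcave (∫⋯∫⁻_s, F ∂(fun _ => volume)) := by
  induction s using Finset.induction_on with
  | empty => simpa using hF
  | insert i s hi ih =>
    intro x y a b ha hb' hab
    simp only [lmarginal_insert _ hFm hi]
    have hm : Measurable (∫⋯∫⁻_s, F ∂(fun _ => (volume : Measure ℝ))) := hFm.lmarginal _
    have hsup : ∀ z : ι → ℝ, ⨆ t : ℝ,
        (∫⋯∫⁻_s, F ∂(fun _ => volume)) (Function.update z i t) ≠ ⊤ := fun z =>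
      ((iSup_le fun t => le_iSup (∫⋯∫⁻_s, F ∂(fun _ => volume)) _).trans_lt
        (lt_top_iff_ne_top.2 (hb s))).ne
    refine prekopa_leindler_real (hm.comp (measurable_update x)) (hm.comp (measurable_update y))
      (hm.comp (measurable_update _)) ha hb' hab (hsup x) (hsup y) fun t u => ?_
    have := ih (Function.update x i t) (Function.update y i u) a b ha hb' hab
    rwa [← Function.update_smul, ← Function.update_smul, ← Function.update_add] at this

/-- Every fibre of `K` lies in the projection of `K` to the coordinates in `s`, which is compact and
so has finite volume. -/
theorem lmarginal_indicator_ne_top {K : Set (ι → ℝ)} (hK : IsCompact K) (s : Finset ι) :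
    ⨆ x, (∫⋯∫⁻_s, (K.indicator 1) ∂(fun _ => (volume : Measure ℝ))) x ≠ ⊤ := by
  let T : Set (∀ i : s, ℝ) := (fun x (i : s) => x i) '' K
  have hT : IsCompact T := hK.image (by fun_prop)
  refine ((iSup_le fun x => ?_).trans_lt
    (hT.measure_lt_top (μ := Measure.pi fun _ : s => (volume : Measure ℝ)))).ne
  rw [← lintegral_indicator_one hT.measurableSet]
  refine lintegral_mono fun y => ?_
  by_cases h : Function.updateFinset x s y ∈ K
  · have : y ∈ T := ⟨_, h, by ext i; simp [Function.updateFinset]⟩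
    simp [h, this]
  · simp [h]

end Marginal

/-- The distribution of the first coordinate of a point of a convex compact set has a bounded
log-concave density. -/
theorem exists_logConcave_density_coord {n : ℕ} {K : Set (Fin (n + 1) → ℝ)} (hK : IsCompact K)
    (hKc : Convex ℝ K) :
    ∃ f : ℝ → ℝ≥0∞, Measurable f ∧ IsLogConcave f ∧ ⨆ t, f t ≠ ⊤ ∧
      ∀ φ : ℝ → ℝ≥0∞, Measurable φ → ∫⁻ x in K, φ (x 0) = ∫⁻ t, φ t * f t := by
  have hm : Measurable (K.indicator (1 : (Fin (n + 1) → ℝ) → ℝ≥0∞)) :=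
    measurable_one.indicator hK.measurableSet
  let s : Finset (Fin (n + 1)) := Finset.univ.erase 0
  let G := ∫⋯∫⁻_s, (K.indicator (1 : (Fin (n + 1) → ℝ) → ℝ≥0∞)) ∂(fun _ => (volume : Measure ℝ))
  have hGm : Measurable G := hm.lmarginal _
  have hlog : IsLogConcave G :=
    hKc.isLogConcave_indicator.lmarginal hm (lmarginal_indicator_ne_top hK) s
  have hsup := lmarginal_indicator_ne_top hK s
  refine ⟨fun t => G (Function.update 0 0 t), hGm.comp (measurable_update _), ?_, ?_, ?_⟩
  · intro x y a b ha hb hab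
    have := hlog (Function.update 0 0 x) (Function.update 0 0 y) a b ha hb hab
    rwa [← Function.update_smul, ← Function.update_smul, ← Function.update_add, smul_zero,
      smul_zero, add_zero] at this
  · exact ((iSup_le fun t => le_iSup G _).trans_lt (lt_top_iff_ne_top.2 hsup)).ne
  · intro φ hφ
    have hφm : Measurable fun x : Fin (n + 1) → ℝ => φ (x 0) := hφ.comp (measurable_pi_apply 0)
    have h1 : ∫⁻ x in K, φ (x 0) = ∫⁻ x, φ (x 0) * K.indicator 1 x := by
      rw [← lintegral_indicator hK.measurableSet]
      refine lintegral_congr fun x => ?_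
      by_cases hx : x ∈ K <;> simp [hx]
    rw [h1, volume_pi, lintegral_eq_lmarginal_univ 0,
      lmarginal_erase (fun x => φ (x 0) * K.indicator 1 x) (hφm.mul hm) (Finset.mem_univ 0)]
    refine lintegral_congr fun t => ?_
    refine Eq.trans (lintegral_congr fun y => ?_)
      (lintegral_const_mul (φ t) (hm.comp measurable_updateFinset))
    simp [Function.updateFinset]
    rfl

/-- Writing `v` as a multiple of `b 0` also covers `v = 0`, so rotation arguments need no case
split. -/
theorem exists_orthonormalBasis_eq_norm_smul {n : ℕ} (v : EuclideanSpace ℝ (Fin (n + 1))) :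
    ∃ b : OrthonormalBasis (Fin (n + 1)) ℝ (EuclideanSpace ℝ (Fin (n + 1))), v = ‖v‖ • b 0 := by
  by_cases hv : v = 0
  · exact ⟨EuclideanSpace.basisFun _ ℝ, by simp [hv]⟩
  have hv' : ‖v‖ ≠ 0 := norm_ne_zero_iff.2 hv
  have ho : Orthonormal ℝ (({0} : Set (Fin (n + 1))).domRestrict fun _ => ‖v‖⁻¹ • v) := by
    refine ⟨fun i => ?_, fun i j hij => absurd (Subsingleton.elim i j) hij⟩
    simp [norm_smul, hv']
  obtain ⟨b, hb⟩ := ho.exists_orthonormalBasis_extension_of_card_eq (by simp)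
  exact ⟨b, by rw [hb 0 rfl, smul_inv_smul₀ hv']⟩

/-- The distribution of `⟪θ, x⟫` for a point of a convex compact set has a bounded
log-concave density. -/
theorem exists_logConcave_density_inner {n : ℕ} {K : Set (EuclideanSpace ℝ (Fin n))}
    (hK : IsCompact K) (hKc : Convex ℝ K) {θ : EuclideanSpace ℝ (Fin n)} (hθ : ‖θ‖ = 1) :
    ∃ f : ℝ → ℝ≥0∞, Measurable f ∧ IsLogConcave f ∧ ⨆ t, f t ≠ ⊤ ∧
      ∀ φ : ℝ → ℝ≥0∞, Measurable φ → ∫⁻ x in K, φ (inner ℝ x θ) = ∫⁻ t, φ t * f t := by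
  cases n with
  | zero => simp [Subsingleton.elim θ 0] at hθ
  | succ n =>
    obtain ⟨b, hb⟩ := exists_orthonormalBasis_eq_norm_smul θ
    rw [hθ, one_smul] at hb
    let ψ := b.repr.toContinuousLinearEquiv.trans (EuclideanSpace.equiv (Fin (n + 1)) ℝ)
    have hψ : MeasurePreserving ψ volume volume :=
      (PiLp.volume_preserving_ofLp (Fin (n + 1))).comp b.measurePreserving_repr
    obtain ⟨f, hf, hlog, hsup, h⟩ := exists_logConcave_density_coord (hK.image ψ.continuous)
      (hKc.linear_image ψ.toLinearMap)
    refine ⟨f, hf, hlog, hsup, fun φ hφ => ?_⟩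
    have h1 := hψ.setLIntegral_comp_preimage (hK.image ψ.continuous).measurableSet
      (f := fun x => φ (x 0)) (hφ.comp (measurable_pi_apply 0))
    rw [← h φ hφ, ← h1, Set.preimage_image_eq _ ψ.injective]
    refine lintegral_congr fun x => ?_
    rw [hb, real_inner_comm, ← b.repr_apply_apply]
    rfl

/-! ### The weight of order `-1/2` -/

/-- The function `|x| ^ (-1/2)`, with value `∞` at zero. -/
noncomputable def invSqrt (x : ℝ) : ℝ≥0∞ := ‖x‖ₑ ^ (-(1 / 2) : ℝ)

theorem measurable_invSqrt : Measurable invSqrt := by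
  unfold invSqrt
  fun_prop

theorem invSqrt_mul (x y : ℝ) : invSqrt (x * y) = invSqrt x * invSqrt y := by
  rw [invSqrt, enorm_mul, ENNReal.mul_rpow_of_ne_top (by simp) (by simp), invSqrt, invSqrt]

theorem invSqrt_abs (x : ℝ) : invSqrt |x| = invSqrt x := by
  simp [invSqrt]

theorem invSqrt_zero : invSqrt 0 = ⊤ := by
  simp [invSqrt]

theorem invSqrt_one : invSqrt 1 = 1 := by
  simp [invSqrt]

theorem invSqrt_ne_zero (x : ℝ) : invSqrt x ≠ 0 := by
  simp [invSqrt]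

theorem invSqrt_ne_top {x : ℝ} (hx : x ≠ 0) : invSqrt x ≠ ⊤ := by
  simp [invSqrt, hx]

theorem invSqrt_of_pos {x : ℝ} (hx : 0 < x) :
    invSqrt x = ENNReal.ofReal (x ^ (-(1 / 2) : ℝ)) := by
  rw [invSqrt, Real.enorm_of_nonneg hx.le, ENNReal.ofReal_rpow_of_pos hx]

theorem invSqrt_anti {x y : ℝ} (h : |x| ≤ |y|) : invSqrt y ≤ invSqrt x := by
  unfold invSqrt
  rw [ENNReal.rpow_neg, ENNReal.rpow_neg, ENNReal.inv_le_inv]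
  refine ENNReal.rpow_le_rpow ?_ (by norm_num)
  exact enorm_le_iff_norm_le.2 h

theorem lintegral_comp_abs_real (h : ℝ → ℝ≥0∞) :
    ∫⁻ x : ℝ, h |x| = 2 * ∫⁻ x in Set.Ioi (0 : ℝ), h x := by
  have h1 : ∫⁻ x in Set.Ioi (0 : ℝ), h |x| = ∫⁻ x in Set.Ioi (0 : ℝ), h x :=
    setLIntegral_congr_fun measurableSet_Ioi fun x hx => by rw [abs_of_pos hx]
  have h2 : ∫⁻ x in Set.Iio (0 : ℝ), h |x| = ∫⁻ x in Set.Ioi (0 : ℝ), h x := by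
    rw [← h1, ← (Measure.measurePreserving_neg (volume : Measure ℝ)).setLIntegral_comp_preimage_emb
      (MeasurableEquiv.neg ℝ).measurableEmbedding]
    simp
  rw [← lintegral_add_compl (fun x => h |x|) (measurableSet_Ioi (a := (0 : ℝ))), Set.compl_Ioi,
    ← setLIntegral_congr Iio_ae_eq_Iic, h1, h2, two_mul]

theorem lintegral_invSqrt_Ioc {L : ℝ} (hL : 0 < L) :
    ∫⁻ t in Set.Ioc 0 L, invSqrt t = ENNReal.ofReal (2 * L) * invSqrt L := by
  have h1 : ∫⁻ t in Set.Ioc 0 L, invSqrt t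
      = ∫⁻ t in Set.Ioc 0 L, ENNReal.ofReal (t ^ (-(1 / 2) : ℝ)) :=
    setLIntegral_congr_fun measurableSet_Ioc fun t ht => invSqrt_of_pos ht.1
  have hint := (intervalIntegral.intervalIntegrable_rpow' (a := 0) (b := L)
    (show (-1 : ℝ) < -(1 / 2) by norm_num)).1
  have hnn : 0 ≤ᵐ[volume.restrict (Set.Ioc 0 L)] fun t : ℝ => t ^ (-(1 / 2) : ℝ) :=
    (ae_restrict_iff' measurableSet_Ioc).2
      (Filter.Eventually.of_forall fun t ht => Real.rpow_nonneg ht.1.le _)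
  rw [h1, ← ofReal_integral_eq_lintegral_ofReal hint hnn, invSqrt_of_pos hL,
    ← ENNReal.ofReal_mul (by positivity), ← intervalIntegral.integral_of_le hL.le,
    integral_rpow (Or.inl (by norm_num)), Real.zero_rpow (by norm_num)]
  congr 1
  rw [Real.rpow_add_one hL.ne']
  ring

/-- Split at `|t| = L`: inside, bound `f` by `B` and integrate the weight; outside, bound the weight
by its value at `L` and use the total mass. -/
theorem lintegral_invSqrt_mul_le {f : ℝ → ℝ≥0∞} (hfm : Measurable f) {B : ℝ≥0∞} {L : ℝ}
    (hL : 0 < L) (hfB : ∀ t, f t ≤ B) (hf1 : ∫⁻ t, f t ≤ 1) :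
    ∫⁻ t, invSqrt t * f t ≤ (B * ENNReal.ofReal (4 * L) + 1) * invSqrt L := by
  let h : ℝ → ℝ≥0∞ := (Set.Iic L).indicator invSqrt
  have hm : Measurable h := measurable_invSqrt.indicator measurableSet_Iic
  have hm' : Measurable fun t => h |t| := hm.comp measurable_id.abs
  have hpt : ∀ t, invSqrt t * f t ≤ B * h |t| + invSqrt L * f t := by
    intro t
    by_cases ht : |t| ≤ L
    · refine le_trans ?_ le_self_add
      simp only [h, Set.indicator_of_mem (Set.mem_Iic.2 ht), invSqrt_abs, mul_comm B]
      exact mul_le_mul_right (hfB t) _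
    · refine le_trans ?_ le_add_self
      refine mul_le_mul_left (invSqrt_anti ?_) _
      rw [abs_of_pos hL]
      exact (not_le.1 ht).le
  refine (lintegral_mono hpt).trans ?_
  rw [lintegral_add_right _ (hfm.const_mul _), lintegral_const_mul _ hm',
    lintegral_const_mul _ hfm, lintegral_comp_abs_real, setLIntegral_indicator measurableSet_Iic,
    Set.Iic_inter_Ioi, lintegral_invSqrt_Ioc hL, add_mul, one_mul]
  refine add_le_add (le_of_eq ?_) ((mul_le_mul_right hf1 _).trans (mul_one _).le)
  rw [ENNReal.ofReal_mul zero_le_four, ENNReal.ofReal_mul zero_le_two, ENNReal.ofReal_ofNat,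
    ENNReal.ofReal_ofNat]
  ring

/-! ### Height and spread of log-concave densities -/

theorem IsLogConcave.le_exp_of_nonneg {g : ℝ → ℝ≥0∞} (hg : IsLogConcave g)
    (h1 : ∫⁻ t, g t ≤ 1) {m : ℝ} (hm : 0 < m) (h0 : g 0 = ENNReal.ofReal m)
    (h2 : ∀ t, g t ≤ ENNReal.ofReal (2 * m)) {τ : ℝ} :
    g τ ≤ ENNReal.ofReal (8 * m * Real.exp (-(m / 8 * τ))) := by
  have he : (1 / 4 : ℝ) < Real.exp (-1) := by
    have := Real.exp_neg_one_gt_d9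
    linarith
  rcases le_or_gt τ (8 / m) with h | h
  · refine (h2 τ).trans (ENNReal.ofReal_le_ofReal ?_)
    have h3 : m / 8 * τ ≤ 1 := by
      calc m / 8 * τ ≤ m / 8 * (8 / m) := by gcongr
        _ = 1 := by field_simp
    have : Real.exp (-1) ≤ Real.exp (-(m / 8 * τ)) := Real.exp_le_exp.2 (by linarith)
    nlinarith
  -- If `g` exceeded `m / 4` on all of `(0, 8 / m]`, its mass would be at least 2.
  · obtain ⟨d, ⟨hd0, hd⟩, hgd⟩ : ∃ d ∈ Set.Ioc 0 (8 / m), g d ≤ ENNReal.ofReal (m / 4) := by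
      by_contra! hcon
      have h4 : ∫⁻ t in Set.Ioc 0 (8 / m), ENNReal.ofReal (m / 4) ≤ ∫⁻ t, g t :=
        (setLIntegral_mono' measurableSet_Ioc fun t ht => (hcon t ht).le).trans
          (setLIntegral_le_lintegral _ _)
      rw [setLIntegral_const, Real.volume_Ioc, ← ENNReal.ofReal_mul (by positivity)] at h4
      have h5 : m / 4 * (8 / m - 0) = 2 := by field_simp; norm_num
      rw [h5] at h4
      have := h4.trans h1
      norm_num at this
    have hτ0 : 0 < τ := lt_of_lt_of_le hd0 (hd.trans h.le)
    have hle : Real.exp (-(m / 8 * τ)) * m ≤ 8 * m * Real.exp (-(m / 8 * τ)) := by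
      nlinarith [mul_pos hm (Real.exp_pos (-(m / 8 * τ)))]
    refine le_trans ?_ (ENNReal.ofReal_le_ofReal hle)
    -- A value at `τ` above `m exp (-m τ / 8)` would, by log-concavity between `0` and `τ`, force `g
    -- d ≥ m exp (-m d / 8) ≥ m / e > m / 4`.
    by_contra! hcon
    set H := Real.exp (-(m / 8 * τ)) * m with hH
    have hb : 0 < d / τ := by positivity
    have ha : 0 < 1 - d / τ := by
      rw [sub_pos, div_lt_one hτ0]
      exact hd.trans_lt h
    have h6 := hg 0 τ (1 - d / τ) (d / τ) ha hb (by ring)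
    have h7 : (1 - d / τ) • (0 : ℝ) + (d / τ) • τ = d := by
      simp [hτ0.ne']
    rw [h7, h0] at h6
    have hHpos : 0 < H := by positivity
    have h8 : ENNReal.ofReal m ^ (1 - d / τ) * ENNReal.ofReal H ^ (d / τ)
        ≤ ENNReal.ofReal (m / 4) := by
      refine le_trans ?_ (h6.trans hgd)
      gcongr
    rw [ENNReal.ofReal_rpow_of_pos hm, ENNReal.ofReal_rpow_of_pos hHpos,
      ← ENNReal.ofReal_mul (by positivity), ENNReal.ofReal_le_ofReal_iff (by positivity), hH,
      Real.mul_rpow (by positivity) hm.le, mul_left_comm, ← Real.rpow_add hm, ← Real.exp_mul,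
      sub_add_cancel, Real.rpow_one] at h8
    have h9 : -(m / 8 * τ) * (d / τ) = -(m / 8 * d) := by field_simp
    have h10 : m / 8 * d ≤ 1 := by
      calc m / 8 * d ≤ m / 8 * (8 / m) := by gcongr
        _ = 1 := by field_simp
    rw [h9] at h8
    have : Real.exp (-1) ≤ Real.exp (-(m / 8 * d)) := Real.exp_le_exp.2 (by linarith)
    nlinarith

theorem IsLogConcave.comp_add_mul {f : ℝ → ℝ≥0∞} (hf : IsLogConcave f) (c ε : ℝ) :
    IsLogConcave fun t => f (c + ε * t) := by
  intro x y a b ha hb hab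
  refine (hf (c + ε * x) (c + ε * y) a b ha hb hab).trans_eq ?_
  congr 1
  simp only [smul_eq_mul]
  linear_combination c * hab

theorem IsLogConcave.le_exp {f : ℝ → ℝ≥0∞} (hf : IsLogConcave f)
    (h1 : ∫⁻ t, f t ≤ 1) {m t₀ : ℝ} (hm : 0 < m) (h0 : f t₀ = ENNReal.ofReal m)
    (h2 : ∀ t, f t ≤ ENNReal.ofReal (2 * m)) (t : ℝ) :
    f t ≤ ENNReal.ofReal (8 * m * Real.exp (-(m / 8 * |t - t₀|))) := by
  rcases le_total t₀ t with h | h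
  · have := (hf.comp_add_mul t₀ 1).le_exp_of_nonneg (by
      simpa only [one_mul, lintegral_add_left_eq_self] using h1) hm (by simpa using h0)
      (fun t => h2 _) (τ := t - t₀)
    rw [abs_of_nonneg (sub_nonneg.2 h)]
    simpa using this
  · have := (hf.comp_add_mul t₀ (-1)).le_exp_of_nonneg (by
      simpa only [neg_mul, one_mul, ← sub_eq_add_neg, lintegral_sub_left_eq_self] using h1) hm
      (by simpa using h0) (fun t => h2 _) (τ := t₀ - t)
    rw [abs_sub_comm, abs_of_nonneg (sub_nonneg.2 h)]
    simpa using this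

theorem lintegral_sq_mul_exp {m : ℝ} (hm : 0 < m) :
    ∫⁻ t in Set.Ioi (0 : ℝ), ENNReal.ofReal (t ^ 2 * (8 * m * Real.exp (-(m / 8 * t))))
      = ENNReal.ofReal (8192 / m ^ 2) := by
  have h := Real.integral_rpow_mul_exp_neg_mul_Ioi (a := 3) (r := m / 8) (by norm_num) (by positivity)
  have hi : IntegrableOn (fun t : ℝ => t ^ (2 : ℝ) * Real.exp (-(m / 8) * t)) (Set.Ioi 0) := by
    simpa using integrableOn_rpow_mul_exp_neg_mul_rpow (p := 1) (s := 2) (b := m / 8) (by norm_num)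
      (by norm_num) (by positivity)
  have heq : ∀ t : ℝ, t ^ 2 * (8 * m * Real.exp (-(m / 8 * t)))
      = 8 * m * (t ^ (2 : ℝ) * Real.exp (-(m / 8) * t)) := by
    intro t
    rw [Real.rpow_two, neg_mul]
    ring
  simp only [heq]
  rw [← ofReal_integral_eq_lintegral_ofReal (hi.const_mul _) (Filter.Eventually.of_forall fun t => by
    dsimp only [Pi.zero_apply]; rw [Real.rpow_two]; positivity), integral_const_mul]
  congr 1
  have h3 : (3 : ℝ) - 1 = 2 := by norm_num
  have hG : Real.Gamma 3 = 2 := by simp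
  simp only [h3, ← neg_mul] at h
  rw [h, hG, show (3 : ℝ) = (3 : ℕ) by norm_num, Real.rpow_natCast]
  field_simp
  norm_num

theorem IsLogConcave.lintegral_sq_le {f : ℝ → ℝ≥0∞} (hf : IsLogConcave f)
    (h1 : ∫⁻ t, f t ≤ 1) {m t₀ : ℝ} (hm : 0 < m) (h0 : f t₀ = ENNReal.ofReal m)
    (h2 : ∀ t, f t ≤ ENNReal.ofReal (2 * m)) :
    ∫⁻ t, ENNReal.ofReal ((t - t₀) ^ 2) * f t ≤ ENNReal.ofReal (16384 / m ^ 2) := by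
  calc ∫⁻ t, ENNReal.ofReal ((t - t₀) ^ 2) * f t
      ≤ ∫⁻ t, ENNReal.ofReal (|t - t₀| ^ 2 * (8 * m * Real.exp (-(m / 8 * |t - t₀|)))) := by
        refine lintegral_mono fun t => ?_
        rw [ENNReal.ofReal_mul (by positivity), sq_abs]
        gcongr
        exact hf.le_exp h1 hm h0 h2 t
    _ = ∫⁻ t, ENNReal.ofReal (|t| ^ 2 * (8 * m * Real.exp (-(m / 8 * |t|)))) :=
        lintegral_sub_right_eq_self
          (fun t => ENNReal.ofReal (|t| ^ 2 * (8 * m * Real.exp (-(m / 8 * |t|))))) t₀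
    _ = ENNReal.ofReal (16384 / m ^ 2) := by
        rw [lintegral_comp_abs_real
          (fun t => ENNReal.ofReal (t ^ 2 * (8 * m * Real.exp (-(m / 8 * t))))),
          lintegral_sq_mul_exp hm, ← ENNReal.ofReal_ofNat 2, ← ENNReal.ofReal_mul (by norm_num)]
        congr 1
        ring

/-- A log-concave probability density on the line is at most a constant over its standard
deviation. -/
theorem IsLogConcave.le_of_variance_ge {f : ℝ → ℝ≥0∞} (hf : IsLogConcave f)
    (hsup : ⨆ t, f t ≠ ⊤) (h1 : ∫⁻ t, f t = 1) {L : ℝ} (hL : 0 < L)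
    (hvar : ∀ s, ENNReal.ofReal (L ^ 2) ≤ ∫⁻ t, ENNReal.ofReal ((t - s) ^ 2) * f t) (t : ℝ) :
    f t ≤ ENNReal.ofReal (256 / L) := by
  have hS0 : ⨆ t, f t ≠ 0 := by
    intro h
    have : ∀ t, f t = 0 := by simpa using h
    simp [this] at h1
  -- The supremum need not be attained; a point above half of it suffices.
  obtain ⟨t₀, ht₀⟩ := lt_iSup_iff.1 (ENNReal.half_lt_self hS0 hsup)
  have hfin : ∀ t, f t ≠ ⊤ := fun t => ((le_iSup f t).trans_lt (lt_top_iff_ne_top.2 hsup)).ne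
  set m := (f t₀).toReal with hm_def
  have h0 : f t₀ = ENNReal.ofReal m := (ENNReal.ofReal_toReal (hfin t₀)).symm
  have hm : 0 < m := ENNReal.toReal_pos (ne_bot_of_gt ht₀) (hfin t₀)
  have h2 : ∀ t, f t ≤ ENNReal.ofReal (2 * m) := by
    intro t
    refine (le_iSup f t).trans ?_
    rw [ENNReal.ofReal_mul zero_le_two, ← h0, ENNReal.ofReal_ofNat, mul_comm]
    exact (ENNReal.div_le_iff two_ne_zero (by simp)).1 ht₀.le
  -- The second moment is controlled about `t₀`, not about the mean, hence the lower bound is needed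
  -- for every centre. Since `16384 = 128 ^ 2`, it gives `L m ≤ 128`.
  have h3 := (hvar t₀).trans (hf.lintegral_sq_le h1.le hm h0 h2)
  rw [ENNReal.ofReal_le_ofReal_iff (by positivity), le_div_iff₀ (by positivity)] at h3
  refine (h2 t).trans (ENNReal.ofReal_le_ofReal ?_)
  rw [le_div_iff₀ hL]
  have : L * m ≤ 128 := abs_le_of_sq_le_sq' (by nlinarith) (by norm_num) |>.2
  linarith

/-! ### Exchanging the factors of a product measure -/

/-- If integrating out any single variable against `μ` is bounded by `A` times integrating it
out against `ν`, then the same holds, with `A ^ card ι`, for the product measures. -/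
theorem lintegral_pi_le_pow_mul_lintegral_pi {ι X : Type*} [Fintype ι] [MeasurableSpace X]
    {μ ν : Measure X} [SigmaFinite μ] [SigmaFinite ν] {F : (ι → X) → ℝ≥0∞} (hF : Measurable F)
    [DecidableEq ι] {A : ℝ≥0∞}
    (h : ∀ x i, ∫⁻ y, F (Function.update x i y) ∂μ ≤ A * ∫⁻ y, F (Function.update x i y) ∂ν) :
    ∫⁻ x, F x ∂Measure.pi (fun _ => μ) ≤ A ^ Fintype.card ι * ∫⁻ x, F x ∂Measure.pi (fun _ => ν) := by
  -- Hybrid measures: coordinates in `s` carry `μ`, the others `ν`.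
  let m : Finset ι → ι → Measure X := fun s i => if i ∈ s then μ else ν
  have hsf : ∀ s i, SigmaFinite (m s i) := by
    intro s i
    by_cases hi : i ∈ s <;> simp only [m, hi, if_true, if_false] <;> infer_instance
  have key : ∀ s : Finset ι,
      ∫⁻ x, F x ∂Measure.pi (m s) ≤ A ^ s.card * ∫⁻ x, F x ∂Measure.pi (fun _ => ν) := by
    intro s
    induction s using Finset.induction_on with
    | empty => simp [m]
    | insert i s hi ih =>
      have hstep : ∫⁻ x, F x ∂Measure.pi (m (insert i s)) ≤ A * ∫⁻ x, F x ∂Measure.pi (m s) := by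
        rcases isEmpty_or_nonempty (ι → X) with he | ⟨⟨x⟩⟩
        · simp [lintegral_of_isEmpty]
        rw [lintegral_eq_lmarginal_univ x, lintegral_eq_lmarginal_univ x,
          lmarginal_erase' F hF (Finset.mem_univ i), lmarginal_erase' F hF (Finset.mem_univ i)]
        have hcongr : ∀ G : (ι → X) → ℝ≥0∞,
            (∫⋯∫⁻_Finset.univ.erase i, G ∂m (insert i s)) x
              = (∫⋯∫⁻_Finset.univ.erase i, G ∂m s) x := by
          intro G
          have : (fun j : (Finset.univ.erase i : Finset ι) => m (insert i s) j)
              = fun j : (Finset.univ.erase i : Finset ι) => m s j := by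
            ext1 j
            have : (j : ι) ≠ i := Finset.ne_of_mem_erase j.2
            simp [m, this]
          rw [lmarginal, lmarginal, this]
        have h1 : m (insert i s) i = μ := by simp [m]
        have h2 : m s i = ν := by simp [m, hi]
        rw [hcongr, h1, h2, lmarginal, lmarginal,
          ← lintegral_const_mul]
        · exact lintegral_mono fun y => h _ i
        · have hG : Measurable fun z : ι → X => ∫⁻ y, F (Function.update z i y) ∂ν :=
            Measurable.lintegral_prod_right' (f := fun p : (ι → X) × X =>
              F (Function.update p.1 i p.2)) (hF.comp measurable_update')
          exact hG.comp measurable_updateFinset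
      rw [Finset.card_insert_of_notMem hi, pow_succ', mul_assoc]
      exact hstep.trans (mul_le_mul_right ih A)
  simpa [m] using key Finset.univ

/-! ### Determinants of Gaussian matrices -/

/-- The moment of order `-1/2` of a standard Gaussian variable. -/
noncomputable def gaussianInvSqrtMoment : ℝ≥0∞ := ∫⁻ t, invSqrt t ∂gaussianReal 0 1

theorem gaussianInvSqrtMoment_ne_zero : gaussianInvSqrtMoment ≠ 0 := by
  rw [gaussianInvSqrtMoment, Ne, lintegral_eq_zero_iff measurable_invSqrt]
  intro h
  obtain ⟨t, ht⟩ := h.exists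
  exact invSqrt_ne_zero t ht

theorem gaussianInvSqrtMoment_ne_top : gaussianInvSqrtMoment ≠ ⊤ := by
  rw [gaussianInvSqrtMoment, gaussianReal_of_var_ne_zero 0 one_ne_zero,
    lintegral_withDensity_eq_lintegral_mul _ (measurable_gaussianPDF 0 1) measurable_invSqrt]
  have hle : ∀ t, gaussianPDF 0 1 t ≤ 1 := by
    intro t
    rw [gaussianPDF, gaussianPDFReal, ← ENNReal.ofReal_one]
    refine ENNReal.ofReal_le_ofReal (mul_le_one₀ ?_ (Real.exp_nonneg _) ?_)
    · refine inv_le_one_of_one_le₀ (Real.one_le_sqrt.2 ?_)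
      have := Real.pi_gt_three
      simp
      linarith
    · rw [Real.exp_le_one_iff, neg_div, neg_nonpos]
      positivity
  have := lintegral_invSqrt_mul_le (measurable_gaussianPDF 0 1) (B := 1) one_pos hle
    (lintegral_gaussianPDF_eq_one 0 one_ne_zero).le
  simp only [Pi.mul_apply, mul_comm (gaussianPDF 0 1 _)]
  refine (this.trans_lt ?_).ne
  rw [invSqrt_one]
  finiteness

section Gaussian

variable {n : ℕ}

local notation "𝔼" n:max => EuclideanSpace ℝ (Fin n)

theorem lintegral_invSqrt_inner_stdGaussian {E : Type*} [NormedAddCommGroup E]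
    [InnerProductSpace ℝ E] [FiniteDimensional ℝ E] [MeasurableSpace E] [BorelSpace E] (v : E) :
    ∫⁻ x, invSqrt (inner ℝ v x) ∂stdGaussian E = invSqrt ‖v‖ * gaussianInvSqrtMoment := by
  have h := IsGaussian.map_eq_gaussianReal (μ := stdGaussian E) (innerSL ℝ v)
  rw [integral_strongDual_stdGaussian, variance_dual_stdGaussian, innerSL_apply_norm] at h
  have h2 := gaussianReal_map_const_mul (μ := 0) (v := 1) ‖v‖
  have h3 : gaussianReal 0 (‖v‖ ^ 2).toNNReal = (gaussianReal 0 1).map (‖v‖ * ·) := by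
    rw [h2, mul_zero, mul_one]
    congr 1
    ext
    simp
  calc ∫⁻ x, invSqrt (inner ℝ v x) ∂stdGaussian E
      = ∫⁻ t, invSqrt t ∂(stdGaussian E).map (innerSL ℝ v) := by
        rw [lintegral_map measurable_invSqrt (by fun_prop)]
        rfl
    _ = ∫⁻ t, invSqrt (‖v‖ * t) ∂gaussianReal 0 1 := by
        rw [h, h3, lintegral_map measurable_invSqrt (by fun_prop)]
    _ = invSqrt ‖v‖ * gaussianInvSqrtMoment := by
        simp only [invSqrt_mul]
        rw [lintegral_const_mul _ measurable_invSqrt, gaussianInvSqrtMoment]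

theorem invSqrt_abs_rpow (x : ℝ) {p : ℝ} (hp : 0 ≤ p) : invSqrt (|x| ^ p) = invSqrt x ^ p := by
  rw [← invSqrt_abs x, invSqrt, invSqrt, Real.enorm_rpow_of_nonneg (abs_nonneg x) hp,
    ← ENNReal.rpow_mul, ← ENNReal.rpow_mul, mul_comm]

theorem invSqrt_prod {ι : Type*} (s : Finset ι) (f : ι → ℝ) :
    invSqrt (∏ i ∈ s, f i) = ∏ i ∈ s, invSqrt (f i) :=
  map_prod (⟨⟨invSqrt, invSqrt_one⟩, invSqrt_mul⟩ : ℝ →* ℝ≥0∞) f s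

/-- AM–GM for the squared coordinates: `‖x‖ ^ 2 ≥ n ∏ |x i| ^ (2 / n)`. The product form prepares
for Hölder's inequality with `n` equal exponents. -/
theorem invSqrt_norm_le_prod (hn : n ≠ 0) (x : 𝔼 n) :
    invSqrt ‖x‖ ≤ invSqrt √n * ∏ i, invSqrt (x i) ^ (1 / n : ℝ) := by
  have hn' : (0 : ℝ) < n := Nat.cast_pos.2 (Nat.pos_of_ne_zero hn)
  have hpow : ∀ i, invSqrt (x i) ^ (1 / n : ℝ) = invSqrt (|x i| ^ (1 / n : ℝ)) := fun i =>
    (invSqrt_abs_rpow (x i) (by positivity)).symm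
  simp only [hpow]
  rw [← invSqrt_prod, ← invSqrt_mul]
  refine invSqrt_anti ?_
  rw [abs_norm, abs_of_nonneg (by positivity)]
  refine (sq_le_sq₀ (by positivity) (norm_nonneg x)).1 ?_
  have h := Real.geom_mean_le_arith_mean_weighted Finset.univ (fun _ : Fin n => (1 / n : ℝ))
    (fun i => x i ^ 2) (fun _ _ => by positivity) (by simp [hn'.ne']) (fun _ _ => by positivity)
  have heq : ∀ i, (|x i| ^ (1 / n : ℝ)) ^ 2 = (x i ^ 2) ^ (1 / n : ℝ) := by
    intro i
    rw [← sq_abs (x i), ← Real.rpow_natCast, ← Real.rpow_natCast, ← Real.rpow_mul (abs_nonneg _),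
      ← Real.rpow_mul (abs_nonneg _), mul_comm]
  rw [mul_pow, Real.sq_sqrt hn'.le, ← Finset.prod_pow, EuclideanSpace.real_norm_sq_eq]
  simp only [heq]
  rw [← Finset.mul_sum] at h
  calc (n : ℝ) * ∏ i, (x i ^ 2) ^ (1 / n : ℝ) ≤ n * (1 / n * ∑ i, x i ^ 2) := by gcongr
    _ = ∑ i, x i ^ 2 := by field_simp

theorem lintegral_invSqrt_norm_stdGaussian_le (hn : n ≠ 0) :
    ∫⁻ x, invSqrt ‖x‖ ∂stdGaussian (𝔼 n) ≤ invSqrt √n * gaussianInvSqrtMoment := by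
  refine (lintegral_mono fun x => invSqrt_norm_le_prod hn x).trans ?_
  have hm : ∀ i : Fin n, Measurable fun x : 𝔼 n => invSqrt (x i) := fun i =>
    measurable_invSqrt.comp (by fun_prop)
  rw [lintegral_const_mul _ (Finset.measurable_prod _ fun i _ => (hm i).pow_const _)]
  refine mul_le_mul_right ?_ _
  have hn' : (n : ℝ) ≠ 0 := Nat.cast_ne_zero.2 hn
  refine (ENNReal.lintegral_prod_norm_pow_le Finset.univ (fun i _ => (hm i).aemeasurable)
    (by simp [hn']) (fun _ _ => by positivity)).trans ?_
  have h : ∀ i : Fin n, ∫⁻ x : 𝔼 n, invSqrt (x i) ∂stdGaussian (𝔼 n) = gaussianInvSqrtMoment := by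
    intro i
    have := lintegral_invSqrt_inner_stdGaussian (EuclideanSpace.single i (1 : ℝ))
    simpa [invSqrt_one, EuclideanSpace.inner_single_left] using this
  simp only [h, Finset.prod_const, Finset.card_univ, Fintype.card_fin]
  rw [← ENNReal.rpow_natCast, ← ENNReal.rpow_mul, one_div_mul_cancel hn', ENNReal.rpow_one]

/-- The determinant of the matrix with the given rows. -/
noncomputable def rowDet (M : Fin n → 𝔼 n) : ℝ := (Matrix.of fun i j => M i j).det

theorem continuous_rowDet : Continuous (rowDet (n := n)) := by
  unfold rowDet
  refine Continuous.matrix_det ?_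
  fun_prop

theorem measurable_rowDet : Measurable (rowDet (n := n)) := continuous_rowDet.measurable

/-- `v` is the vector of cofactors along row `i`. -/
theorem exists_rowDet_update_eq_inner (M : Fin n → 𝔼 n) (i : Fin n) :
    ∃ v : 𝔼 n, ∀ y, rowDet (Function.update M i y) = inner ℝ v y := by
  refine ⟨WithLp.toLp 2 fun j => (Matrix.of fun i j => M i j).adjugate j i, fun y => ?_⟩
  have : (Matrix.of fun k j => Function.update M i y k j)
      = (Matrix.of fun i j => M i j).updateRow i y := by
    ext k j
    by_cases hk : k = i
    · subst hk; simp
    · simp [hk]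
  rw [rowDet, this, ← Matrix.cramer_transpose_apply, Matrix.cramer_eq_adjugate_mulVec,
    ← Matrix.adjugate_transpose, PiLp.inner_apply, Matrix.mulVec, dotProduct]
  exact Finset.sum_congr rfl fun j _ => mul_comm _ _

/-- Expressing all rows in the basis `b` preserves `|det|` and leaves one non-zero entry in the
first row; expand along it. -/
theorem abs_rowDet_cons (b : OrthonormalBasis (Fin (n + 1)) ℝ (𝔼 (n + 1))) (r : ℝ)
    (M : Fin n → 𝔼 (n + 1)) :
    |rowDet (Fin.cons (r • b 0) M : Fin (n + 1) → 𝔼 (n + 1))|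
      = |r| * |rowDet fun i => WithLp.toLp 2 fun j : Fin n => b.repr (M i) j.succ| := by
  set v : Fin (n + 1) → 𝔼 (n + 1) := Fin.cons (r • b 0) M with hv
  have hrot : |rowDet v| = |rowDet fun i => b.repr (v i)| := by
    let B : Matrix (Fin (n + 1)) (Fin (n + 1)) ℝ := Matrix.of fun j k => b j k
    have hB : B * B.transpose = 1 := by
      ext i j
      have := orthonormal_iff_ite.1 b.orthonormal j i
      rw [PiLp.inner_apply] at this
      simpa [B, Matrix.mul_apply, Matrix.one_apply, eq_comm] using this
    have hdet : |B.det| = 1 := by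
      have := congrArg Matrix.det hB
      rw [Matrix.det_mul, Matrix.det_transpose, Matrix.det_one, ← sq] at this
      simpa using (sq_eq_sq_iff_abs_eq_abs B.det 1).1 (by rw [this, one_pow])
    have hmul : (Matrix.of fun i j => b.repr (v i) j)
        = (Matrix.of fun i j => v i j) * B.transpose := by
      ext i j
      simp [B, Matrix.mul_apply, b.repr_apply_apply, PiLp.inner_apply]
    rw [rowDet, rowDet, hmul, Matrix.det_mul, Matrix.det_transpose, abs_mul, hdet, mul_one]
  rw [hrot, rowDet, Matrix.det_succ_row_zero, Fin.sum_univ_succ, Finset.sum_eq_zero, add_zero,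
    ← abs_mul]
  · simp [hv, rowDet]
    exact Or.inl rfl
  · intro j _
    simp [hv]

theorem measurePreserving_tail_stdGaussian :
    MeasurePreserving (fun x : 𝔼 (n + 1) => (WithLp.toLp 2 fun j : Fin n => x j.succ : 𝔼 n))
      (stdGaussian (𝔼 (n + 1))) (stdGaussian (𝔼 n)) := by
  refine ⟨by fun_prop, ?_⟩
  rw [← map_pi_eq_stdGaussian, ← map_pi_eq_stdGaussian, Measure.map_map (by fun_prop) (by fun_prop),
    ← ((measurePreserving_snd).comp (measurePreserving_piFinSuccAbove
      (fun _ : Fin (n + 1) => gaussianReal 0 1) 0)).map_eq,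
    Measure.map_map (by fun_prop) (by fun_prop)]
  rfl

/-- Fix the first row `x` and rotate it onto an axis. The other rows stay standard Gaussian, and
dropping their component along `x` leaves an `n × n` Gaussian matrix whose law does not depend on
`x`. -/
theorem lintegral_invSqrt_rowDet_stdGaussian_succ :
    ∫⁻ M, invSqrt (rowDet M) ∂Measure.pi (fun _ => stdGaussian (𝔼 (n + 1)))
      = (∫⁻ x, invSqrt ‖x‖ ∂stdGaussian (𝔼 (n + 1)))
        * ∫⁻ M, invSqrt (rowDet M) ∂Measure.pi (fun _ => stdGaussian (𝔼 n)) := by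
  have hm : Measurable fun M : Fin (n + 1) → 𝔼 (n + 1) => invSqrt (rowDet M) :=
    measurable_invSqrt.comp measurable_rowDet
  have hm' : Measurable fun M : Fin n → 𝔼 n => invSqrt (rowDet M) :=
    measurable_invSqrt.comp measurable_rowDet
  have hfix : ∀ x : 𝔼 (n + 1), ∫⁻ M : Fin n → 𝔼 (n + 1),
      invSqrt (rowDet (Fin.cons x M : Fin (n + 1) → 𝔼 (n + 1)))
        ∂Measure.pi (fun _ => stdGaussian (𝔼 (n + 1)))
      = invSqrt ‖x‖ * ∫⁻ M, invSqrt (rowDet M) ∂Measure.pi (fun _ => stdGaussian (𝔼 n)) := by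
    intro x
    obtain ⟨b, hb⟩ := exists_orthonormalBasis_eq_norm_smul x
    have hT := measurePreserving_pi (fun _ : Fin n => stdGaussian (𝔼 (n + 1)))
      (fun _ : Fin n => stdGaussian (𝔼 n)) fun _ => measurePreserving_tail_stdGaussian.comp
        ⟨b.repr.continuous.measurable, stdGaussian_map b.repr⟩
    rw [← hT.lintegral_comp hm']
    refine Eq.trans (lintegral_congr fun M => ?_)
      (lintegral_const_mul _ (hm'.comp hT.measurable))
    rw [← invSqrt_mul, ← invSqrt_abs, ← invSqrt_abs (‖x‖ * _), abs_mul]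
    conv_lhs => rw [hb]
    rw [abs_rowDet_cons]
    rfl
  have hσ : SigmaFinite (stdGaussian (𝔼 (n + 1))) := inferInstance
  have he := (measurePreserving_piFinSuccAbove (α := fun _ => 𝔼 (n + 1))
    (fun _ : Fin (n + 1) => stdGaussian (𝔼 (n + 1))) 0).symm
  rw [← he.lintegral_comp hm]
  refine (lintegral_prod _ (hm.comp he.measurable).aemeasurable).trans ?_
  refine Eq.trans (lintegral_congr fun x => ?_)
    (lintegral_mul_const _ (measurable_invSqrt.comp measurable_norm))
  refine Eq.trans ?_ (hfix x)
  refine lintegral_congr fun M => ?_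
  simp [MeasurableEquiv.piFinSuccAbove]
  rfl

theorem lintegral_invSqrt_rowDet_stdGaussian_le (n : ℕ) :
    ∫⁻ M, invSqrt (rowDet M) ∂Measure.pi (fun _ => stdGaussian (𝔼 n))
      ≤ gaussianInvSqrtMoment ^ n * invSqrt √n.factorial := by
  induction n with
  | zero =>
    simp [rowDet, invSqrt_one]
  | succ n ih =>
    rw [lintegral_invSqrt_rowDet_stdGaussian_succ]
    refine (mul_le_mul' (lintegral_invSqrt_norm_stdGaussian_le n.succ_ne_zero) ih).trans_eq ?_
    rw [Nat.factorial_succ, Nat.cast_mul, Real.sqrt_mul (by positivity), invSqrt_mul, pow_succ]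
    ring

end Gaussian

/-! ### Volume of a simplex from below -/

theorem rowDet_le_volume_simplexHull {n : ℕ} (X : Fin n → EuclideanSpace ℝ (Fin n)) :
    |rowDet X| / (n : ℝ) ^ n ≤ volume.real (simplexHull (Fin.cons 0 X)) := by
  let b := (EuclideanSpace.basisFun (Fin n) ℝ).toBasis
  let f : EuclideanSpace ℝ (Fin n) →ₗ[ℝ] EuclideanSpace ℝ (Fin n) := b.constr ℝ X
  have hf : ∀ t, f t = ∑ i, t i • X i := fun t => by
    simp [f, b, Module.Basis.constr_apply_fintype]
  have hdet : LinearMap.det f = rowDet X := by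
    rw [← LinearMap.det_toMatrix b, ← Matrix.det_transpose, rowDet]
    congr 1
    ext i j
    simp [LinearMap.toMatrix_apply, f, b]
  -- The cube `[0, 1/n] ^ n` lies in the standard simplex. Using it instead of the exact `1 / n!`
  -- loses only an exponential factor.
  let C : Set (EuclideanSpace ℝ (Fin n)) :=
    (WithLp.ofLp : EuclideanSpace ℝ (Fin n) → Fin n → ℝ) ⁻¹' Set.univ.pi fun _ => Set.Icc 0 (1 / n : ℝ)
  have hC : volume C = ENNReal.ofReal (1 / n) ^ n := by
    rw [(PiLp.volume_preserving_ofLp (Fin n)).measure_preimage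
      (MeasurableSet.univ_pi fun _ => measurableSet_Icc).nullMeasurableSet, volume_pi_pi]
    simp
  have hsub : f '' C ⊆ simplexHull (Fin.cons 0 X) := by
    rintro _ ⟨t, ht, rfl⟩
    have ht' : ∀ i, t i ∈ Set.Icc 0 (1 / n : ℝ) := fun i => ht i (Set.mem_univ i)
    have hsum : ∑ i, t i ≤ 1 := by
      refine (Finset.sum_le_sum fun i _ => (ht' i).2).trans ?_
      simp [mul_inv_le_one]
    let w : Fin (n + 1) → ℝ := Fin.cons (1 - ∑ i, t i) t
    have hw := (convex_convexHull ℝ (Set.range (Fin.cons 0 X : Fin (n + 1) → _))).sum_mem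
      (t := Finset.univ) (w := w) (z := (Fin.cons 0 X : Fin (n + 1) → _))
      (fun i _ => by
        refine Fin.cases ?_ (fun j => ?_) i
        · simpa [w] using hsum
        · simpa [w] using (ht' j).1)
      (by simp [w, Fin.sum_univ_succ])
      (fun i _ => subset_convexHull ℝ _ (Set.mem_range_self i))
    rw [hf, simplexHull]
    simpa [w, Fin.sum_univ_succ] using hw
  have hfin : volume (simplexHull (Fin.cons 0 X)) ≠ ⊤ :=
    ((Set.finite_range _).isCompact_convexHull (𝕜 := ℝ)).measure_lt_top.ne
  refine le_trans (le_of_eq ?_) (measureReal_mono hsub hfin)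
  rw [measureReal_def, Measure.addHaar_image_linearMap, hC, hdet, ENNReal.toReal_mul,
    ENNReal.toReal_pow, ENNReal.toReal_ofReal (abs_nonneg _), ENNReal.toReal_ofReal (by positivity)]
  ring

/-! ### Negative moments on isotropic bodies -/

section Isotropic

variable {n : ℕ} {K : ConvexBody (EuclideanSpace ℝ (Fin n))} {L : ℝ}

theorem IsIsotropic.isProbabilityMeasure (hK : IsIsotropic K L) :
    IsProbabilityMeasure (volume.restrict (K : Set (EuclideanSpace ℝ (Fin n)))) :=
  ⟨by rw [Measure.restrict_apply_univ, hK.volume_eq_one]⟩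

/-- The mean vanishes, so the second moment about `s` is `L ^ 2 + s ^ 2`. -/
theorem IsIsotropic.lintegral_sq_sub_ge (hK : IsIsotropic K L) {θ : EuclideanSpace ℝ (Fin n)}
    (hθ : ‖θ‖ = 1) (s : ℝ) :
    ENNReal.ofReal (L ^ 2)
      ≤ ∫⁻ x in (K : Set (EuclideanSpace ℝ (Fin n))), ENNReal.ofReal ((inner ℝ x θ - s) ^ 2) := by
  have := hK.isProbabilityMeasure
  have hint : ∀ g : EuclideanSpace ℝ (Fin n) → ℝ, Continuous g →
      Integrable g (volume.restrict (K : Set (EuclideanSpace ℝ (Fin n)))) := fun g hg =>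
    hg.continuousOn.integrableOn_compact K.isCompact
  have hid : Integrable (fun x : EuclideanSpace ℝ (Fin n) => x)
      (volume.restrict (K : Set (EuclideanSpace ℝ (Fin n)))) :=
    continuous_id.continuousOn.integrableOn_compact K.isCompact
  have hmean : ∫ x in (K : Set (EuclideanSpace ℝ (Fin n))), inner ℝ x θ = 0 := by
    simp only [real_inner_comm θ]
    rw [integral_inner hid, hK.barycenter_eq_zero, inner_zero_right]
  rw [← ofReal_integral_eq_lintegral_ofReal (hint _ (by fun_prop))
    (Filter.Eventually.of_forall fun x => sq_nonneg _)]
  refine ENNReal.ofReal_le_ofReal ?_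
  have h : ∀ x : EuclideanSpace ℝ (Fin n), (inner ℝ x θ - s) ^ 2
      = (inner ℝ x θ) ^ 2 - 2 * s * inner ℝ x θ + s ^ 2 := fun x => by ring
  simp only [h]
  rw [integral_add (hint _ (by fun_prop)) (hint _ (by fun_prop)),
    integral_sub (hint _ (by fun_prop)) (hint _ (by fun_prop)), integral_const_mul, hmean,
    hK.integral_inner_sq θ hθ, integral_const, probReal_univ]
  simp
  positivity

theorem IsIsotropic.lintegral_invSqrt_inner_le (hK : IsIsotropic K L) (hL : 0 < L)
    (v : EuclideanSpace ℝ (Fin n)) :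
    ∫⁻ x in (K : Set (EuclideanSpace ℝ (Fin n))), invSqrt (inner ℝ v x)
      ≤ 1025 * invSqrt L * invSqrt ‖v‖ := by
  by_cases hv : v = 0
  · simp [hv, invSqrt_zero, ENNReal.mul_top, invSqrt_ne_zero]
  have hv' : ‖v‖ ≠ 0 := norm_ne_zero_iff.2 hv
  set θ := ‖v‖⁻¹ • v with hθ_def
  have hθ : ‖θ‖ = 1 := by simp [hθ_def, norm_smul, hv']
  obtain ⟨f, hf, hlog, hsup, hφ⟩ := exists_logConcave_density_inner K.isCompact K.convex hθ
  have h1 : ∫⁻ t, f t = 1 := by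
    have := hφ 1 measurable_one
    simpa [hK.volume_eq_one] using this.symm
  have hvar : ∀ s, ENNReal.ofReal (L ^ 2) ≤ ∫⁻ t, ENNReal.ofReal ((t - s) ^ 2) * f t := fun s =>
    (hK.lintegral_sq_sub_ge hθ s).trans_eq
      (hφ (fun t => ENNReal.ofReal ((t - s) ^ 2)) (by fun_prop))
  have h2 := lintegral_invSqrt_mul_le hf hL (hlog.le_of_variance_ge hsup h1 hL hvar) h1.le
  -- Density bound `256 / L`, split at distance `L`.
  have h3 : ENNReal.ofReal (256 / L) * ENNReal.ofReal (4 * L) + 1 = 1025 := by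
    rw [← ENNReal.ofReal_mul (by positivity), show 256 / L * (4 * L) = 1024 by field_simp; norm_num]
    norm_num
  rw [h3, ← hφ invSqrt measurable_invSqrt] at h2
  have h4 : ∀ x, invSqrt (inner ℝ v x) = invSqrt (inner ℝ x θ) * invSqrt ‖v‖ := by
    intro x
    rw [← invSqrt_mul, hθ_def, real_inner_smul_right, real_inner_comm]
    congr 1
    field_simp
  simp only [h4]
  have hm : Measurable fun x : EuclideanSpace ℝ (Fin n) => invSqrt (inner ℝ x θ) :=
    measurable_invSqrt.comp (by fun_prop)
  rw [lintegral_mul_const _ hm]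
  gcongr

/-- Each exchanged row costs `1025 L ^ (-1/2) / κ`, and the powers of `κ` cancel against the
Gaussian bound. -/
theorem IsIsotropic.lintegral_invSqrt_rowDet_le (hK : IsIsotropic K L) (hL : 0 < L) :
    ∫⁻ M, invSqrt (rowDet M)
        ∂Measure.pi (fun _ => volume.restrict (K : Set (EuclideanSpace ℝ (Fin n))))
      ≤ (1025 * invSqrt L) ^ n * invSqrt √n.factorial := by
  have := hK.isProbabilityMeasure
  set κ := gaussianInvSqrtMoment with hκ
  have hκ0 : κ ≠ 0 := gaussianInvSqrtMoment_ne_zero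
  have hκt : κ ≠ ⊤ := gaussianInvSqrtMoment_ne_top
  have h := lintegral_pi_le_pow_mul_lintegral_pi
    (μ := volume.restrict (K : Set (EuclideanSpace ℝ (Fin n))))
    (ν := stdGaussian (EuclideanSpace ℝ (Fin n))) (measurable_invSqrt.comp measurable_rowDet)
    (A := 1025 * invSqrt L / κ) fun M i => by
      obtain ⟨v, hv⟩ := exists_rowDet_update_eq_inner M i
      simp only [Function.comp_apply, hv]
      rw [lintegral_invSqrt_inner_stdGaussian]
      refine (hK.lintegral_invSqrt_inner_le hL v).trans_eq ?_
      rw [mul_comm (invSqrt ‖v‖), ← mul_assoc, ENNReal.div_mul_cancel hκ0 hκt]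
  refine h.trans ((mul_le_mul_right (lintegral_invSqrt_rowDet_stdGaussian_le n) _).trans_eq ?_)
  rw [Fintype.card_fin, ← mul_assoc, ← mul_pow, ENNReal.div_mul_cancel hκ0 hκt]

end Isotropic

/-! ### Constants and conclusion -/

theorem invSqrt_pow (x : ℝ) (n : ℕ) : invSqrt (x ^ n) = invSqrt x ^ n :=
  map_pow (⟨⟨invSqrt, invSqrt_one⟩, invSqrt_mul⟩ : ℝ →* ℝ≥0∞) x n

theorem invSqrt_inv_sq {x : ℝ} (hx : 0 < x) : invSqrt (1 / x ^ 2) = ENNReal.ofReal x := by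
  rw [invSqrt_of_pos (by positivity), one_div, Real.inv_rpow (by positivity),
    ← Real.rpow_neg (by positivity), neg_neg, ← Real.sqrt_eq_rpow, Real.sqrt_sq hx.le]

/-- From `n! ≥ (n / e) ^ n ≥ (n / 16) ^ n`; the fourth root of 16 gives the factor 2. -/
theorem invSqrt_sqrt_factorial_le (n : ℕ) :
    invSqrt √n.factorial ≤ (2 * invSqrt √n) ^ n := by
  have h4 : invSqrt (1 / 4) = 2 := by
    have := invSqrt_inv_sq (x := 2) two_pos
    norm_num at this ⊢
    exact this
  rw [← h4, ← invSqrt_mul, ← invSqrt_pow]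
  refine invSqrt_anti ?_
  rw [abs_of_nonneg (by positivity), abs_of_nonneg (by positivity)]
  refine Real.le_sqrt_of_sq_le ?_
  rw [← pow_mul, mul_comm n 2, pow_mul, mul_pow, Real.sq_sqrt (by positivity)]
  have h := Real.pow_div_factorial_le_exp (n : ℝ) (by positivity) n
  rw [div_le_iff₀ (by positivity)] at h
  have h2 : Real.exp n ≤ 16 ^ n := by
    rw [← Real.exp_one_pow]
    gcongr
    have := Real.exp_one_lt_d9
    linarith
  calc ((1 / 4) ^ 2 * (n : ℝ)) ^ n = (n : ℝ) ^ n / 16 ^ n := by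
        rw [show (1 / 4 : ℝ) ^ 2 * n = n / 16 by ring, div_pow]
    _ ≤ Real.exp n * n.factorial / 16 ^ n := by gcongr
    _ ≤ 16 ^ n * n.factorial / 16 ^ n := by gcongr
    _ = n.factorial := by field_simp

theorem mainTheorem4 :
    ∃ c : ℝ, 0 < c ∧
      ∀ (n : ℕ) (K : ConvexBody (EuclideanSpace ℝ (Fin n))) (L : ℝ), IsIsotropic K L →
      ∀ (Ω : Type*) [MeasurableSpace Ω] (P : Measure Ω) [IsProbabilityMeasure P]
        (X : Fin n → Ω → EuclideanSpace ℝ (Fin n)),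
        (∀ i, Measurable (X i)) →
        iIndepFun X P →
        (∀ i, pdf.IsUniform (X i) (K : Set (EuclideanSpace ℝ (Fin n))) P volume) →
        P.real {ω | c ^ n * L ^ n / (n : ℝ) ^ ((n : ℝ) / 2) ≤
            volume.real (simplexHull (Fin.cons 0 (fun i => X i ω)))} >
          1 - 1 / 2 * Real.exp (-(n : ℝ)) := by
  -- `24600 = 12 · 1025 · 2`: row bound times factorial bound, with 12 left for the probability. It
  -- is squared because the moment has order `-1/2`.
  refine ⟨1 / 24600 ^ 2, by positivity, ?_⟩
  intro n K L hK Ω _ P _ X hXm hXi hXu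
  rcases Nat.eq_zero_or_pos n with rfl | hn
  · have hall : ∀ ω, volume.real (simplexHull (Fin.cons 0 (fun i => X i ω))) = 1 := by
      intro ω
      have h1 : simplexHull (Fin.cons 0 (fun i => X i ω))
          = (K : Set (EuclideanSpace ℝ (Fin 0))) := by
        rw [Subsingleton.eq_univ_of_nonempty K.nonempty]
        exact Subsingleton.eq_univ_of_nonempty
          ⟨_, subset_convexHull ℝ _ (Set.mem_range_self (0 : Fin 1))⟩
      rw [h1, measureReal_def, hK.volume_eq_one, ENNReal.toReal_one]
    simp [hall]
  have hsqrt : (n : ℝ) ^ ((n : ℝ) / 2) = √n ^ n := by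
    rw [Real.sqrt_eq_rpow, ← Real.rpow_natCast, ← Real.rpow_mul (by positivity)]
    ring_nf
  -- For `L = 0` the threshold is zero, so this case need not be ruled out.
  rcases hK.const_nonneg.eq_or_lt with hL | hL
  · have hall : ∀ ω, (1 / 24600 ^ 2) ^ n * L ^ n / (n : ℝ) ^ ((n : ℝ) / 2)
        ≤ volume.real (simplexHull (Fin.cons 0 (fun i => X i ω))) := fun ω => by
      simp [← hL, hn.ne']
    rw [Set.eq_univ_of_forall (s := {ω | _ ≤ _}) hall, probReal_univ]
    linarith [Real.exp_pos (-(n : ℝ))]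
  -- Dividing `τ` by `n ^ n` turns `√n ^ n` into `1 / √n ^ n`, which is the required threshold.
  set τ : ℝ := (1 / 24600 ^ 2 * (√n * L)) ^ n with hτ
  have hn' : (0 : ℝ) < n := Nat.cast_pos.2 hn
  have hτ0 : 0 < τ := by positivity
  have hdm : Measurable fun ω => rowDet fun i => X i ω :=
    measurable_rowDet.comp (measurable_pi_lambda _ hXm)
  have hgood : MeasurableSet {ω | τ ≤ |rowDet fun i => X i ω|} :=
    measurableSet_le measurable_const hdm.abs
  have hsub : {ω | τ ≤ |rowDet fun i => X i ω|}
      ⊆ {ω | (1 / 24600 ^ 2) ^ n * L ^ n / (n : ℝ) ^ ((n : ℝ) / 2) ≤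
            volume.real (simplexHull (Fin.cons 0 (fun i => X i ω)))} := by
    intro ω hω
    refine le_trans ?_ (rowDet_le_volume_simplexHull _)
    refine le_trans (le_of_eq ?_) (div_le_div_of_nonneg_right hω (by positivity))
    rw [hsqrt, hτ, mul_pow, mul_pow]
    nth_rewrite 3 [← Real.sq_sqrt hn'.le]
    have : √(n : ℝ) ≠ 0 := (Real.sqrt_pos.2 hn').ne'
    field_simp
    ring
  have hlaw : P.map (fun ω i => X i ω)
      = Measure.pi fun _ => volume.restrict (K : Set (EuclideanSpace ℝ (Fin n))) := by
    rw [(iIndepFun_iff_map_fun_eq_pi_map fun i => (hXm i).aemeasurable).1 hXi]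
    congr 1
    ext1 i
    rw [hXu i, ProbabilityTheory.cond, hK.volume_eq_one, inv_one, one_smul]
  have hE : ∫⁻ ω, invSqrt (rowDet fun i => X i ω) ∂P ≤ ENNReal.ofReal (1 / 12) ^ n * invSqrt τ := by
    have h1 := hK.lintegral_invSqrt_rowDet_le hL
    rw [← hlaw, lintegral_map (f := fun M => invSqrt (rowDet M)) (measurable_invSqrt.comp measurable_rowDet)
      (measurable_pi_lambda _ hXm)] at h1
    refine (h1.trans (mul_le_mul_right (invSqrt_sqrt_factorial_le n) _)).trans_eq ?_
    rw [hτ, invSqrt_pow, ← mul_pow, ← mul_pow, invSqrt_mul, invSqrt_mul, invSqrt_inv_sq (by norm_num)]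
    have : ENNReal.ofReal (1 / 12) * ENNReal.ofReal 24600 = 1025 * 2 := by
      rw [← ENNReal.ofReal_mul (by norm_num)]
      norm_num
    rw [← mul_assoc (ENNReal.ofReal (1 / 12)), this]
    ring
  have hbad : P {ω | τ ≤ |rowDet fun i => X i ω|}ᶜ ≤ ENNReal.ofReal (1 / 12) ^ n := by
    have hτ' : invSqrt τ ≠ ⊤ := invSqrt_ne_top hτ0.ne'
    -- Markov's inequality: a determinant below `τ` has weight at least `invSqrt τ`.
    have h1 := (mul_meas_ge_le_lintegral (μ := P) (measurable_invSqrt.comp hdm)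
      (invSqrt τ)).trans hE
    rw [mul_comm, ENNReal.mul_le_mul_iff_left (invSqrt_ne_zero τ) hτ'] at h1
    refine (measure_mono fun ω hω => ?_).trans h1
    refine invSqrt_anti ?_
    rw [abs_of_pos hτ0]
    exact (not_le.1 (show ¬ τ ≤ _ from hω)).le
  have hbad' : P.real {ω | τ ≤ |rowDet fun i => X i ω|}ᶜ ≤ (1 / 12) ^ n := by
    rw [measureReal_def]
    refine ENNReal.toReal_le_of_le_ofReal (by positivity) (hbad.trans_eq ?_)
    rw [ENNReal.ofReal_pow (by norm_num)]
  rw [probReal_compl_eq_one_sub hgood] at hbad'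
  have hmono := measureReal_mono (μ := P) hsub
  -- Here `12 = 4 · 3`: the 3 beats `e`, and the 4 beats the factor 2 once `n ≥ 1`.
  have hexp : (1 / 12 : ℝ) ^ n < 1 / 2 * Real.exp (-(n : ℝ)) := by
    have h3 : (1 / 3 : ℝ) < Real.exp (-1) := by
      have := Real.exp_neg_one_gt_d9
      linarith
    have h4 : Real.exp (-(n : ℝ)) = Real.exp (-1) ^ n := by
      rw [← Real.exp_nat_mul]
      ring_nf
    rw [h4]
    calc (1 / 12 : ℝ) ^ n = (1 / 4) ^ n * (1 / 3) ^ n := by rw [← mul_pow]; norm_num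
      _ ≤ (1 / 4) ^ 1 * (1 / 3) ^ n := by
          gcongr ?_ * _
          exact pow_le_pow_of_le_one (by norm_num) (by norm_num) hn
      _ < 1 / 2 * (1 / 3) ^ n := by
          have : (0 : ℝ) < (1 / 3) ^ n := by positivity
          linarith
      _ ≤ 1 / 2 * Real.exp (-1) ^ n := by gcongr
  linarith
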